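/- Let $M$ be an $n$-dimensional smooth manifold, $TM$ its tangent bundle with induced coordinates $(x^i,y^i)$, and $\mathcal TM=TM\setminus\{0\}$ the slit tangent bundle. Let $J=dx^i\otimes\frac{\partial}{\partial y^i}$ be the vertical endomorphism and $C=y^i\frac{\partial}{\partial y^i}$ the Liouville vector field. Let $S$ be a spray on $M$, i.e. a smooth vector field on $\mathcal TM$ with $JS=C$ and $[C,S]=S$, and let $\Gamma=[J,S]$ be the canonical nonlinear connection associated to $S$, that is $\Gamma X=[JX,S]-J[X,S]$. For a smooth function $F$ put $d_JF(X)=dF(JX)$ and, for a $2$-form $\Omega$, $(i_\Gamma\Omega)(X,Y)=\Omega(\Gamma X,Y)+\Omega(X,\Gamma Y)$. Consider the Rapcs\'ak system $P_1=(P_S,P_C)$, $$P_S(F)=i_S\,dd_JF,\qquad P_C(F)=\mathcal L_CF-F .$$ For $k\ge 2$ and $x\in\mathcal TM$, the jet $j_k(F)_x$ of a smooth function $F$ defined near $x$ is called a $k$-th order (formal) solution of $P_1$ at $x$ if $$j_{k-2}(P_SF)_x=0\quad\text{and}\quad j_{k-1}(P_CF)_x=0 .$$ **Proposition.** Let $x\in\mathcal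 TM$ and let $j_2(F)_x$ be a second order solution of $P_1$ at $x$. Then $j_2(F)_x$ can be lifted to a third order solution (i.e. there is a smooth function $G$ near $x$ such that $j_2(G)_x=j_2(F)_x$ and $j_3(G)_x$ is a third order solution of $P_1$ at $x$) if and only if $$(i_\Gamma\, dd_JF)_x=0 .$$ -/

import Mathlib

open scoped Manifold ContDiff Topology

noncomputable section

namespace Rapcsak

/-! ### Calculus on the coordinate space `(x, y)` of the tangent bundle

A chart `x` of an `n`-manifold `M` induces the coordinates `(x, y)` on `TM`. The canonical
structures of `TM` and the operators attached to a spray are written here in such coordinates;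
they are tensorial, so that nothing depends on the chart. -/

/-- The space of the induced coordinates `(x, y)` on the tangent bundle of an `n`-manifold. -/
abbrev Coord (n : ℕ) : Type := EuclideanSpace ℝ (Fin n) × EuclideanSpace ℝ (Fin n)

variable {n : ℕ}

/-- The vertical endomorphism `J = dxⁱ ⊗ ∂/∂yⁱ`, that is `J (a, b) = (0, a)`. -/
def vertEnd (n : ℕ) : Coord n →L[ℝ] Coord n :=
  (ContinuousLinearMap.inr ℝ (EuclideanSpace ℝ (Fin n)) (EuclideanSpace ℝ (Fin n))).comp
    (ContinuousLinearMap.fst ℝ (EuclideanSpace ℝ (Fin n)) (EuclideanSpace ℝ (Fin n)))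

/-- The Liouville vector field `C = yⁱ ∂/∂yⁱ`. -/
def liouville (z : Coord n) : Coord n := (0, z.2)

/-- The one-form `d_J F = i_J dF`, that is `(d_J F)(X) = dF (J X)`. -/
def dJ (F : Coord n → ℝ) (z : Coord n) : Coord n [⋀^Fin 1]→L[ℝ] ℝ :=
  ContinuousAlternatingMap.ofSubsingleton ℝ (Coord n) ℝ 0 ((fderiv ℝ F z).comp (vertEnd n))

/-- The two-form `d d_J F`. -/
def ddJ (F : Coord n → ℝ) (z : Coord n) : Coord n [⋀^Fin 2]→L[ℝ] ℝ :=
  extDeriv (dJ F) z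

/-- The operator `P_S F = i_S d d_J F`, with values in one-forms. -/
def opS (S : Coord n → Coord n) (F : Coord n → ℝ) (z : Coord n) : Coord n [⋀^Fin 1]→L[ℝ] ℝ :=
  (ddJ F z).curryLeft (S z)

/-- The operator `P_C F = ℒ_C F - F`. -/
def opC (F : Coord n → ℝ) (z : Coord n) : ℝ :=
  fderiv ℝ F z (liouville z) - F z

/-- The connection `Γ = [J, S]`. By definition `[J, S] X = [J X, S] - J [X, S]` for a vector
field `X`; this is tensorial in `X`, and the tangent vector `X` at `z` is extended here to a
field with constant components. -/
def connection (S : Coord n → Coord n) (z X : Coord n) : Coord n :=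
  VectorField.lieBracket ℝ (fun _ => vertEnd n X) S z
    - vertEnd n (VectorField.lieBracket ℝ (fun _ => X) S z)

/-- `i_Γ d d_J F`, where `Γ = [J, S]`; on two-forms
`(i_Γ Ω)(X, Y) = Ω (Γ X, Y) + Ω (X, Γ Y)`. -/
def iGammaDDJ (S : Coord n → Coord n) (F : Coord n → ℝ) (z X Y : Coord n) : ℝ :=
  ddJ F z ![connection S z X, Y] + ddJ F z ![X, connection S z Y]

/-- The `k`-th order jet at `z` of a map on the coordinate space: the collection of all its
derivatives at `z` of order at most `k`. -/
def jet {V : Type*} [NormedAddCommGroup V] [NormedSpace ℝ V] (k : ℕ) (f : Coord n → V)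
    (z : Coord n) (i : Fin (k + 1)) : ContinuousMultilinearMap ℝ (fun _ : Fin i => Coord n) V :=
  iteratedFDeriv ℝ i f z

/-! ### Sprays, jets and formal solutions on a manifold -/

variable {M : Type*} [TopologicalSpace M] [ChartedSpace (EuclideanSpace ℝ (Fin n)) M]
  [IsManifold (𝓡 n) ∞ M]

/-- The induced coordinates `(x, y)` of `q ∈ TM`, in the chart of `M` around the base point
of `p`. -/
def coords (p q : TangentBundle (𝓡 n) M) : Coord n := extChartAt (𝓡 n).tangent p q

/-- The expression of a function on `TM` in the induced coordinates around `p`. -/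
def localFun (F : TangentBundle (𝓡 n) M → ℝ) (p : TangentBundle (𝓡 n) M) (z : Coord n) : ℝ :=
  F ((extChartAt (𝓡 n).tangent p).symm z)

/-- The components of a vector field on `TM` in the induced coordinates around `p`. -/
def localField (S : ∀ q : TangentBundle (𝓡 n) M, TangentSpace (𝓡 n).tangent q)
    (p : TangentBundle (𝓡 n) M) (z : Coord n) : Coord n :=
  mfderiv (𝓡 n).tangent 𝓘(ℝ, Coord n) (extChartAt (𝓡 n).tangent p)
    ((extChartAt (𝓡 n).tangent p).symm z) (S ((extChartAt (𝓡 n).tangent p).symm z))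

/-- A spray on `M`: a smooth vector field on the slit tangent bundle (the values on the zero
section are irrelevant) with `J S = C` and `[C, S] = S`. -/
structure IsSpray (S : ∀ q : TangentBundle (𝓡 n) M, TangentSpace (𝓡 n).tangent q) : Prop where
  smooth : ContMDiffOn (𝓡 n).tangent (𝓡 n).tangent.tangent ∞
    (fun q => (⟨q, S q⟩ : TangentBundle (𝓡 n).tangent (TangentBundle (𝓡 n) M))) {q | q.2 ≠ 0}
  vertEnd_eq : ∀ p : TangentBundle (𝓡 n) M, ∀ z ∈ (extChartAt (𝓡 n).tangent p).target,
    z.2 ≠ 0 → vertEnd n (localField S p z) = liouville z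
  bracket_eq : ∀ p : TangentBundle (𝓡 n) M, ∀ z ∈ (extChartAt (𝓡 n).tangent p).target,
    z.2 ≠ 0 → VectorField.lieBracket ℝ liouville (localField S p) z = localField S p z

/-- `F` is a smooth function on a neighbourhood of `p` in `TM`. -/
def SmoothNear (F : TangentBundle (𝓡 n) M → ℝ) (p : TangentBundle (𝓡 n) M) : Prop :=
  ∀ᶠ q in 𝓝 p, ContMDiffAt (𝓡 n).tangent 𝓘(ℝ, ℝ) ∞ F q

/-- The jet `j_k(F)_p` of a function on `TM`, in the induced coordinates around `p`. -/
def jetAt (k : ℕ) (F : TangentBundle (𝓡 n) M → ℝ) (p : TangentBundle (𝓡 n) M) (i : Fin (k + 1)) :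
    ContinuousMultilinearMap ℝ (fun _ : Fin i => Coord n) ℝ :=
  jet k (localFun F p) (coords p p) i

/-- `j_{2+l}(F)_p` is a formal solution of order `2 + l` of the system `P₁ = (P_S, P_C)`.
As `P_S` has order two and `P_C` has order one, this says that the `l`-jet of `P_S F`
and the `(l+1)`-jet of `P_C F` vanish at `p`. -/
def IsFormalSolution (l : ℕ) (S : ∀ q : TangentBundle (𝓡 n) M, TangentSpace (𝓡 n).tangent q)
    (F : TangentBundle (𝓡 n) M → ℝ) (p : TangentBundle (𝓡 n) M) : Prop :=
  jet l (opS (localField S p) (localFun F p)) (coords p p) = 0 ∧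
    jet (l + 1) (opC (localFun F p)) (coords p p) = 0

/-- `(i_Γ d d_J F)_p = 0` with `Γ = [J, S]`. -/
def ObstructionVanishes (S : ∀ q : TangentBundle (𝓡 n) M, TangentSpace (𝓡 n).tangent q)
    (F : TangentBundle (𝓡 n) M → ℝ) (p : TangentBundle (𝓡 n) M) : Prop :=
  ∀ X Y : Coord n, iGammaDDJ (localField S p) (localFun F p) (coords p p) X Y = 0

end Rapcsak

end

/-! Work in induced coordinates and write ρ for the one-form `P_S F` and σ for the function `P_C F`.
Lifting the 2-jet means adding a function Q with zero 2-jet, so the only freedom is its third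
derivative T, a symmetric trilinear form. The third order equations at the point become T(C,·,·) = A
and T(S,JX,Z) = B(X,Z), where A = -Hess σ and B(X,Z) = -(∂_Z ρ)(X) - Hess σ(Z,X).

Since JS = C and J² = 0, solvability forces A to be symmetric, B(JX,·) = 0, B(S,·) = A(S,·) and
B(X,JY) = B(Y,JX); `exists_trilinear` shows that these conditions suffice. The first two are
identities, and the third follows from ρ = 0 at the point. The last is exactly i_Γ dd_J F = 0, by
`iGammaDDJ_eq`: antisymmetrizing cancels all third derivatives of F. That formula also gives
necessity, because the obstruction sees only the 2-jet and ∂ρ and Hess σ vanish for a lift. -/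

noncomputable section

set_option maxSynthPendingDepth 3

namespace Rapcsak

variable {n : ℕ}

/-! ### Symmetric trilinear forms with prescribed contractions -/

section Trilinear

variable {V : Type*} [NormedAddCommGroup V] [NormedSpace ℝ V]

/-- A trilinear form extending a bilinear form `A` along the functional `l`: when `l u = 1` and `A`
is symmetric, it is the symmetric form whose contraction with `u` is `A`. -/
def extendAlong (l : V →L[ℝ] ℝ) (u : V) (A : V →L[ℝ] V →L[ℝ] ℝ) : V →L[ℝ] V →L[ℝ] V →L[ℝ] ℝ :=
  l.smulRight A + (l.smulRight A).flip
    + ((ContinuousLinearMap.smulRightL ℝ V (V →L[ℝ] ℝ)).flip l).comp A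
    - l.smulRight (l.smulRight (A u)) - l.smulRight ((A u).smulRight l)
    - (A u).smulRight (l.smulRight l)
    + (A u u) • l.smulRight (l.smulRight l)

/-- When `l u = 1` and `A` is symmetric, this is inclusion–exclusion for V = ℝu ⊕ ker l, with the
form zero on ker l. -/
theorem extendAlong_apply (l : V →L[ℝ] ℝ) (u : V) (A : V →L[ℝ] V →L[ℝ] ℝ) (X Y Z : V) :
    extendAlong l u A X Y Z = l X * A Y Z + l Y * A X Z + l Z * A X Y
      - l X * l Y * A u Z - l X * l Z * A u Y - l Y * l Z * A u X
      + l X * l Y * l Z * A u u := by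
  simp [extendAlong]
  ring

theorem extendAlong_contract {l : V →L[ℝ] ℝ} {u : V} {A : V →L[ℝ] V →L[ℝ] ℝ} (hl : l u = 1)
    (Y Z : V) : extendAlong l u A u Y Z = A Y Z := by
  rw [extendAlong_apply, hl]
  ring

theorem extendAlong_symm₁₂ {l : V →L[ℝ] ℝ} {u : V} {A : V →L[ℝ] V →L[ℝ] ℝ}
    (hA : ∀ X Y, A X Y = A Y X) (X Y Z : V) :
    extendAlong l u A X Y Z = extendAlong l u A Y X Z := by
  rw [extendAlong_apply, extendAlong_apply, hA X Y]
  ring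

theorem extendAlong_symm₂₃ {l : V →L[ℝ] ℝ} {u : V} {A : V →L[ℝ] V →L[ℝ] ℝ}
    (hA : ∀ X Y, A X Y = A Y X) (X Y Z : V) :
    extendAlong l u A X Y Z = extendAlong l u A X Z Y := by
  rw [extendAlong_apply, extendAlong_apply, hA Y Z]
  ring

/-- A symmetric trilinear form is the third derivative at `z₀` of a smooth function whose
derivatives of order at most two vanish at `z₀`. -/
theorem exists_cubic (T : V →L[ℝ] V →L[ℝ] V →L[ℝ] ℝ) (h₁₂ : ∀ X Y Z, T X Y Z = T Y X Z)
    (h₂₃ : ∀ X Y Z, T X Y Z = T X Z Y) (z₀ : V) :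
    ∃ Q : V → ℝ, ContDiff ℝ ∞ Q ∧ Q z₀ = 0 ∧ fderiv ℝ Q z₀ = 0 ∧
      fderiv ℝ (fderiv ℝ Q) z₀ = 0 ∧ fderiv ℝ (fderiv ℝ (fderiv ℝ Q)) z₀ = T := by
  have hu : ∀ z : V, HasFDerivAt (fun z : V => z - z₀) (ContinuousLinearMap.id ℝ V) z :=
    fun z => (hasFDerivAt_id z).sub_const z₀
  have hT : ∀ z : V, HasFDerivAt (fun z : V => T (z - z₀)) T z := fun z => by
    have h := (T.hasFDerivAt (x := z - z₀)).comp z (hu z)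
    rwa [ContinuousLinearMap.comp_id] at h
  have hTT : ∀ z : V, HasFDerivAt (fun z : V => T (z - z₀) (z - z₀)) ((2 : ℝ) • T (z - z₀)) z := by
    intro z
    convert! (hT z).clm_apply (hu z) using 1
    ext X Y
    have := h₁₂ X (z - z₀) Y
    simp only [smul_apply, smul_eq_mul, add_apply,
      ContinuousLinearMap.comp_apply, ContinuousLinearMap.flip_apply,
      ContinuousLinearMap.id_apply]
    rw [this]
    ring
  have hTTT : ∀ z : V, HasFDerivAt (fun z : V => T (z - z₀) (z - z₀) (z - z₀))
      ((3 : ℝ) • T (z - z₀) (z - z₀)) z := by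
    intro z
    convert! (hTT z).clm_apply (hu z) using 1
    ext X
    have := h₂₃ (z - z₀) X (z - z₀)
    simp only [smul_apply, smul_eq_mul, add_apply,
      ContinuousLinearMap.comp_apply, ContinuousLinearMap.flip_apply,
      ContinuousLinearMap.id_apply]
    rw [this]
    ring
  -- The factor 1/6 absorbs the 3 and the 2 that the product rule and the symmetry of `T` produce.
  have d₁ : fderiv ℝ (fun z : V => (1 / 6 : ℝ) • T (z - z₀) (z - z₀) (z - z₀))
      = fun z => (1 / 2 : ℝ) • T (z - z₀) (z - z₀) := by
    funext z
    rw [((hTTT z).fun_const_smul (1 / 6 : ℝ)).fderiv, smul_smul]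
    norm_num
  have d₂ : fderiv ℝ (fun z : V => (1 / 2 : ℝ) • T (z - z₀) (z - z₀)) = fun z => T (z - z₀) := by
    funext z
    rw [((hTT z).fun_const_smul (1 / 2 : ℝ)).fderiv, smul_smul]
    norm_num
  refine ⟨fun z => (1 / 6 : ℝ) • T (z - z₀) (z - z₀) (z - z₀), by fun_prop, by simp, ?_, ?_, ?_⟩
  · rw [d₁]; simp
  · rw [d₁, d₂]; simp
  · rw [d₁, d₂, (hT z₀).fderiv]

end Trilinear

@[simp] theorem vertEnd_apply (X : Coord n) : vertEnd n X = (0, X.1) := rfl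

/-- Existence of a symmetric trilinear form `T` with prescribed contractions `T (C, ·, ·) = A` and
`T (S, J X, ·) = B (X, ·)`, where `J S = C ≠ 0`. -/
theorem exists_trilinear (s c : Coord n) (hsc : vertEnd n s = c) (hc : c ≠ 0)
    (A B : Coord n →L[ℝ] Coord n →L[ℝ] ℝ) (hA : ∀ X Y, A X Y = A Y X)
    (hBv : ∀ X Z, B (vertEnd n X) Z = 0) (hBs : ∀ Z, B s Z = A s Z)
    (hBB : ∀ X Y, B X (vertEnd n Y) = B Y (vertEnd n X)) :
    ∃ T : Coord n →L[ℝ] Coord n →L[ℝ] Coord n →L[ℝ] ℝ,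
      (∀ X Y Z, T X Y Z = T Y X Z) ∧ (∀ X Y Z, T X Y Z = T X Z Y) ∧
      (∀ Y Z, T c Y Z = A Y Z) ∧ ∀ X Z, T s (vertEnd n X) Z = B X Z := by
  have hs : s.1 ≠ 0 := by
    rintro h
    apply hc
    rw [← hsc, vertEnd_apply, h]; rfl
  obtain ⟨ε, hε⟩ := SeparatingDual.exists_eq_one (R := ℝ) hs
  subst hsc
  set φ : Coord n →L[ℝ] ℝ := ε.comp (ContinuousLinearMap.snd ℝ _ _) with hφ
  set θ : Coord n →L[ℝ] ℝ := ε.comp (ContinuousLinearMap.fst ℝ _ _) with hθ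
  -- `T₁` settles the contraction with C; the residual `B'` must then be met by a form annihilated
  -- by C.
  set T₁ := extendAlong φ (vertEnd n s) A with hT₁
  have h₁ : ∀ Y Z, T₁ (vertEnd n s) Y Z = A Y Z :=
    extendAlong_contract (by simp [hφ, hε])
  have hs₁₂ : ∀ X Y Z, T₁ X Y Z = T₁ Y X Z := extendAlong_symm₁₂ hA
  have hs₂₃ : ∀ X Y Z, T₁ X Y Z = T₁ X Z Y := extendAlong_symm₂₃ hA
  set B' : Coord n →L[ℝ] Coord n →L[ℝ] ℝ := B - (T₁ s).comp (vertEnd n) with hB'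
  have hB'a : ∀ X Z, B' X Z = B X Z - T₁ s (vertEnd n X) Z := fun X Z => by simp [hB']
  have hJJ : ∀ X : Coord n, vertEnd n (vertEnd n X) = 0 := fun X => by simp
  have hB'v : ∀ X Z, B' (vertEnd n X) Z = 0 := fun X Z => by
    rw [hB'a, hBv, hJJ]; simp
  have hB's : ∀ Z, B' s Z = 0 := fun Z => by
    rw [hB'a, hBs, hs₁₂, h₁, sub_self]
  have hB'B : ∀ X Y, B' X (vertEnd n Y) = B' Y (vertEnd n X) := fun X Y => by
    rw [hB'a, hB'a, hBB, hs₂₃]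
  -- `K` lifts vertical vectors through J. As K(JX) and X differ by a vertical vector, `B'` does not
  -- distinguish them.
  set K : Coord n →L[ℝ] Coord n := (ContinuousLinearMap.inl ℝ _ _).comp
    (ContinuousLinearMap.snd ℝ (EuclideanSpace ℝ (Fin n)) (EuclideanSpace ℝ (Fin n))) with hK
  have hKJ : ∀ X Z, B' (K (vertEnd n X)) Z = B' X Z := fun X Z => by
    have : X = K (vertEnd n X) + vertEnd n (X.2, 0) := by ext <;> simp [hK]
    conv_rhs => rw [this, map_add]
    rw [add_apply, hB'v, add_zero]
  -- `q` is a symmetric form with q(JX,·) = B'(X,·); the subtracted term removes the double count on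
  -- vertical vectors. Since B'(s,·) = 0, `q` kills C, and so does its extension along `θ`, because
  -- `θ` kills vertical vectors.
  set q : Coord n →L[ℝ] Coord n →L[ℝ] ℝ :=
    B'.comp K + (B'.comp K).flip - ((B'.comp K).flip.comp ((vertEnd n).comp K)).flip with hq
  have hqa : ∀ X Z, q X Z = B' (K X) Z + B' (K Z) X - B' (K X) (vertEnd n (K Z)) := fun X Z => by
    simp [hq]
  have hqs : ∀ X Z, q X Z = q Z X := fun X Z => by
    rw [hqa, hqa, hB'B]; ring
  have hqJ : ∀ X Z, q (vertEnd n X) Z = B' X Z := fun X Z => by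
    rw [hqa, hKJ, hKJ, hB'B X]; ring
  have hqc : ∀ Z, q (vertEnd n s) Z = 0 := fun Z => by rw [hqJ, hB's]
  have hθv : ∀ X, θ (vertEnd n X) = 0 := fun X => by simp [hθ]
  refine ⟨T₁ + extendAlong θ s q, fun X Y Z => ?_, fun X Y Z => ?_, fun Y Z => ?_, fun X Z => ?_⟩
  · simp only [add_apply]
    rw [hs₁₂, extendAlong_symm₁₂ hqs]
  · simp only [add_apply]
    rw [hs₂₃, extendAlong_symm₂₃ hqs]
  · simp only [add_apply]
    rw [h₁, extendAlong_apply, hθv, hqc, hqc, hqs s (vertEnd n s), hqc]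
    ring
  · simp only [add_apply]
    rw [extendAlong_contract (l := θ) hε, hqJ, hB'a]
    ring

/-! ### The operators in coordinates -/

/-- The second derivative of `f` at `z`. -/
abbrev hess (f : Coord n → ℝ) (z : Coord n) : Coord n →L[ℝ] Coord n →L[ℝ] ℝ :=
  fderiv ℝ (fderiv ℝ f) z

theorem hess_symm {f : Coord n → ℝ} {z : Coord n} (hf : ContDiffAt ℝ ∞ f z) (X Y : Coord n) :
    hess f z X Y = hess f z Y X :=
  (hf.isSymmSndFDerivAt (by simpa using WithTop.coe_le_coe.2 (le_top : (2 : ℕ∞) ≤ ⊤))) X Y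

theorem contDiffAt_fderiv {V : Type*} [NormedAddCommGroup V] [NormedSpace ℝ V]
    {f : Coord n → V} {z : Coord n} (hf : ContDiffAt ℝ ∞ f z) :
    ContDiffAt ℝ ∞ (fderiv ℝ f) z :=
  hf.fderiv_right (by simp)

theorem differentiableAt_of_contDiffAt {V : Type*} [NormedAddCommGroup V] [NormedSpace ℝ V]
    {f : Coord n → V} {z : Coord n} (hf : ContDiffAt ℝ ∞ f z) : DifferentiableAt ℝ f z :=
  hf.differentiableAt (by simp)

/-- Linear forms as alternating forms of degree one. -/
def oneFormEquiv (n : ℕ) : (Coord n →L[ℝ] ℝ) ≃ₗᵢ[ℝ] (Coord n [⋀^Fin 1]→L[ℝ] ℝ) :=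
  ContinuousAlternatingMap.ofSubsingletonLIE (0 : Fin 1)

theorem ddJ_apply {f : Coord n → ℝ} {z : Coord n} (hf : ContDiffAt ℝ ∞ f z) (X Y : Coord n) :
    ddJ f z ![X, Y] = hess f z X (vertEnd n Y) - hess f z Y (vertEnd n X) := by
  have hd : DifferentiableAt ℝ (fderiv ℝ f) z :=
    differentiableAt_of_contDiffAt (contDiffAt_fderiv hf)
  have hdJ : DifferentiableAt ℝ (dJ f) z :=
    ((oneFormEquiv n).differentiableAt (x := (fderiv ℝ f z).comp (vertEnd n))).comp z
        (hd.clm_comp (differentiableAt_const _))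
  have key : ∀ W : Fin 1 → Coord n, ∀ Z, fderiv ℝ (fun z => dJ f z W) z Z
      = hess f z Z (vertEnd n (W 0)) := by
    intro W Z
    have : (fun z => dJ f z W) = fun z => fderiv ℝ f z (vertEnd n (W 0)) := rfl
    rw [this, fderiv_clm_apply hd (differentiableAt_const _)]
    simp
  rw [ddJ, extDeriv_apply hdJ]
  simp only [key]
  simp [Fin.removeNth]
  ring

/-- The components of the one-form `P_S F`. -/
def sprayForm (S : Coord n → Coord n) (f : Coord n → ℝ) (z : Coord n) : Coord n →L[ℝ] ℝ :=
  (hess f z (S z)).comp (vertEnd n) - (hess f z).flip (vertEnd n (S z))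

theorem sprayForm_apply (S : Coord n → Coord n) (f : Coord n → ℝ) (z X : Coord n) :
    sprayForm S f z X = hess f z (S z) (vertEnd n X) - hess f z X (vertEnd n (S z)) := rfl

theorem opS_eq (S : Coord n → Coord n) {f : Coord n → ℝ} {z : Coord n}
    (hf : ContDiffAt ℝ ∞ f z) :
    opS S f z = oneFormEquiv n (sprayForm S f z) := by
  ext W
  have : Matrix.vecCons (S z) W = ![S z, W 0] := by
    ext i : 1
    fin_cases i <;> rfl
  change ddJ f z (Matrix.vecCons (S z) W) = sprayForm S f z (W 0)
  rw [this, ddJ_apply hf, sprayForm_apply]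

/-! ### Low order jets in terms of iterated derivatives -/

theorem jet_eq_iff_two {V : Type*} [NormedAddCommGroup V] [NormedSpace ℝ V]
    {f g : Coord n → V} {z : Coord n} :
    jet 2 f z = jet 2 g z ↔ f z = g z ∧ fderiv ℝ f z = fderiv ℝ g z ∧
      fderiv ℝ (fderiv ℝ f) z = fderiv ℝ (fderiv ℝ g) z := by
  constructor
  · intro h
    have h0 : iteratedFDeriv ℝ 0 f z = iteratedFDeriv ℝ 0 g z := congrFun h 0
    have h1 : iteratedFDeriv ℝ 1 f z = iteratedFDeriv ℝ 1 g z := congrFun h 1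
    have h2 : iteratedFDeriv ℝ 2 f z = iteratedFDeriv ℝ 2 g z := congrFun h 2
    refine ⟨?_, ?_, ?_⟩
    · simpa using congrArg (fun T => T 0) h0
    · refine ContinuousLinearMap.ext fun X => ?_
      simpa using congrArg (fun T => T ![X]) h1
    · refine ContinuousLinearMap.ext fun X => ContinuousLinearMap.ext fun Y => ?_
      simpa [iteratedFDeriv_two_apply] using congrArg (fun T => T ![X, Y]) h2
  · rintro ⟨h0, h1, h2⟩
    funext i
    fin_cases i
    · change iteratedFDeriv ℝ 0 f z = iteratedFDeriv ℝ 0 g z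
      ext m; simp [h0]
    · change iteratedFDeriv ℝ 1 f z = iteratedFDeriv ℝ 1 g z
      ext m; simp [h1]
    · change iteratedFDeriv ℝ 2 f z = iteratedFDeriv ℝ 2 g z
      ext m; simp [iteratedFDeriv_two_apply, h2]

theorem jet_eq_iff_one {V : Type*} [NormedAddCommGroup V] [NormedSpace ℝ V]
    {f g : Coord n → V} {z : Coord n} :
    jet 1 f z = jet 1 g z ↔ f z = g z ∧ fderiv ℝ f z = fderiv ℝ g z := by
  constructor
  · intro h
    have h0 : iteratedFDeriv ℝ 0 f z = iteratedFDeriv ℝ 0 g z := congrFun h 0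
    have h1 : iteratedFDeriv ℝ 1 f z = iteratedFDeriv ℝ 1 g z := congrFun h 1
    refine ⟨?_, ?_⟩
    · simpa using congrArg (fun T => T 0) h0
    · refine ContinuousLinearMap.ext fun X => ?_
      simpa using congrArg (fun T => T ![X]) h1
  · rintro ⟨h0, h1⟩
    funext i
    fin_cases i
    · change iteratedFDeriv ℝ 0 f z = iteratedFDeriv ℝ 0 g z
      ext m; simp [h0]
    · change iteratedFDeriv ℝ 1 f z = iteratedFDeriv ℝ 1 g z
      ext m; simp [h1]

theorem jet_zero_fun {V : Type*} [NormedAddCommGroup V] [NormedSpace ℝ V] (k : ℕ)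
    (z : Coord n) : jet k (fun _ => (0 : V)) z = 0 := by
  funext i
  simp [jet, iteratedFDeriv_fun_zero]

theorem jet_two_eq_zero_iff {V : Type*} [NormedAddCommGroup V] [NormedSpace ℝ V]
    {f : Coord n → V} {z : Coord n} :
    jet 2 f z = 0 ↔ f z = 0 ∧ fderiv ℝ f z = 0 ∧ fderiv ℝ (fderiv ℝ f) z = 0 := by
  rw [← jet_zero_fun 2 z, jet_eq_iff_two]
  simp

theorem jet_one_eq_zero_iff {V : Type*} [NormedAddCommGroup V] [NormedSpace ℝ V]
    {f : Coord n → V} {z : Coord n} :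
    jet 1 f z = 0 ↔ f z = 0 ∧ fderiv ℝ f z = 0 := by
  rw [← jet_zero_fun 1 z, jet_eq_iff_one]
  simp

theorem jet_zero_eq_zero_iff {V : Type*} [NormedAddCommGroup V] [NormedSpace ℝ V]
    {f : Coord n → V} {z : Coord n} : jet 0 f z = 0 ↔ f z = 0 := by
  constructor
  · intro h
    have h0 : iteratedFDeriv ℝ 0 f z = 0 := congrFun h 0
    simpa using congrArg (fun T => T 0) h0
  · intro h
    funext i
    fin_cases i
    change iteratedFDeriv ℝ 0 f z = 0
    ext m; simp [h]

/-! ### First and second derivatives of the two operators -/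

/-- The Liouville vector field as a linear map. -/
def liouvilleCLM (n : ℕ) : Coord n →L[ℝ] Coord n :=
  (ContinuousLinearMap.inr ℝ (EuclideanSpace ℝ (Fin n)) (EuclideanSpace ℝ (Fin n))).comp
    (ContinuousLinearMap.snd ℝ (EuclideanSpace ℝ (Fin n)) (EuclideanSpace ℝ (Fin n)))

@[simp] theorem liouvilleCLM_apply (z : Coord n) : liouvilleCLM n z = (0, z.2) := rfl

theorem hasFDerivAt_liouville (z : Coord n) : HasFDerivAt liouville (liouvilleCLM n) z :=
  (liouvilleCLM n).hasFDerivAt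

theorem contDiffAt_opC {f : Coord n → ℝ} {z : Coord n} (hf : ContDiffAt ℝ ∞ f z) :
    ContDiffAt ℝ ∞ (opC f) z :=
  ((contDiffAt_fderiv hf).clm_apply (liouvilleCLM n).contDiff.contDiffAt).sub hf

theorem fderiv_opC {f : Coord n → ℝ} {z : Coord n} (hf : ContDiffAt ℝ ∞ f z) (X : Coord n) :
    fderiv ℝ (opC f) z X = hess f z X (liouville z) + fderiv ℝ f z (0, X.2) - fderiv ℝ f z X := by
  have hd := differentiableAt_of_contDiffAt (contDiffAt_fderiv hf)
  have h := (hd.hasFDerivAt.clm_apply (hasFDerivAt_liouville z)).sub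
    (differentiableAt_of_contDiffAt hf).hasFDerivAt
  change fderiv ℝ ((fun w => fderiv ℝ f w (liouville w)) - f) z X = _
  rw [h.fderiv]
  simp
  ring

theorem fderiv_sprayForm {S : Coord n → Coord n} {f : Coord n → ℝ} {z : Coord n}
    (hf : ContDiffAt ℝ ∞ f z) (hS : DifferentiableAt ℝ S z) (Z X : Coord n) :
    fderiv ℝ (sprayForm S f) z Z X =
      fderiv ℝ (hess f) z Z (S z) (vertEnd n X) + hess f z (fderiv ℝ S z Z) (vertEnd n X)
        - fderiv ℝ (hess f) z Z X (vertEnd n (S z))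
        - hess f z X (vertEnd n (fderiv ℝ S z Z)) := by
  have hd : DifferentiableAt ℝ (hess f) z :=
    differentiableAt_of_contDiffAt (contDiffAt_fderiv (contDiffAt_fderiv hf))
  have hJS : HasFDerivAt (fun w => vertEnd n (S w)) ((vertEnd n).comp (fderiv ℝ S z)) z :=
    (vertEnd n).hasFDerivAt.comp z hS.hasFDerivAt
  have hP : DifferentiableAt ℝ (sprayForm S f) z := by
    unfold sprayForm
    refine ((hd.clm_apply hS).clm_comp (differentiableAt_const _)).sub ?_
    exact (((ContinuousLinearMap.flipₗᵢ ℝ (Coord n) (Coord n) ℝ).differentiableAt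
      (x := hess f z)).comp z hd).clm_apply hJS.differentiableAt
  have h1 : HasFDerivAt (fun w => sprayForm S f w X)
      ((ContinuousLinearMap.apply ℝ ℝ X).comp (fderiv ℝ (sprayForm S f) z)) z :=
    (ContinuousLinearMap.apply ℝ ℝ X).hasFDerivAt.comp z hP.hasFDerivAt
  have h2 := ((hd.hasFDerivAt.clm_apply hS.hasFDerivAt).clm_apply
      (hasFDerivAt_const (vertEnd n X) z)).sub
    ((hd.hasFDerivAt.clm_apply (hasFDerivAt_const X z)).clm_apply hJS)
  have h3 := congrArg (fun L => L Z) (h1.unique h2)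
  simp only [ContinuousLinearMap.comp_apply, ContinuousLinearMap.apply_apply] at h3
  rw [h3]
  simp
  ring

theorem hess_opC {f : Coord n → ℝ} {z : Coord n} (hf : ∀ᶠ w in 𝓝 z, ContDiffAt ℝ ∞ f w)
    (Z X : Coord n) :
    hess (opC f) z Z X = fderiv ℝ (hess f) z Z X (liouville z) + hess f z X (0, Z.2)
      + hess f z Z (0, X.2) - hess f z Z X := by
  have hfz := hf.self_of_nhds
  have hd : DifferentiableAt ℝ (fderiv ℝ f) z :=
    differentiableAt_of_contDiffAt (contDiffAt_fderiv hfz)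
  have hdd : DifferentiableAt ℝ (hess f) z :=
    differentiableAt_of_contDiffAt (contDiffAt_fderiv (contDiffAt_fderiv hfz))
  have hP := differentiableAt_of_contDiffAt (contDiffAt_fderiv (contDiffAt_opC hfz))
  have h1 : HasFDerivAt (fun w => fderiv ℝ (opC f) w X)
      ((ContinuousLinearMap.apply ℝ ℝ X).comp (hess (opC f) z)) z :=
    (ContinuousLinearMap.apply ℝ ℝ X).hasFDerivAt.comp z hP.hasFDerivAt
  have h2 := (((hdd.hasFDerivAt.clm_apply (hasFDerivAt_const X z)).clm_apply
      (hasFDerivAt_liouville z)).add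
    (hd.hasFDerivAt.clm_apply (hasFDerivAt_const ((0, X.2) : Coord n) z))).sub
    (hd.hasFDerivAt.clm_apply (hasFDerivAt_const X z))
  have h4 := h2.congr_of_eventuallyEq (f₁ := fun w => fderiv ℝ (opC f) w X)
    (hf.mono fun w hw => fderiv_opC hw X)
  have h3 := congrArg (fun L => L Z) (h1.unique h4)
  simp only [ContinuousLinearMap.comp_apply, ContinuousLinearMap.apply_apply] at h3
  rw [h3]
  simp
  ring

theorem fderiv_hess_symm₁₂ {f : Coord n → ℝ} {z : Coord n} (hf : ContDiffAt ℝ ∞ f z)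
    (X Y Z : Coord n) : fderiv ℝ (hess f) z X Y Z = fderiv ℝ (hess f) z Y X Z :=
  congrArg (fun L => L Z) ((contDiffAt_fderiv hf).isSymmSndFDerivAt
    (by simpa using WithTop.coe_le_coe.2 (le_top : (2 : ℕ∞) ≤ ⊤)) X Y)

/-- Symmetry of the Hessian holds on a neighbourhood, so it can be differentiated. -/
theorem fderiv_hess_symm₂₃ {f : Coord n → ℝ} {z : Coord n}
    (hf : ∀ᶠ w in 𝓝 z, ContDiffAt ℝ ∞ f w) (X Y Z : Coord n) :
    fderiv ℝ (hess f) z X Y Z = fderiv ℝ (hess f) z X Z Y := by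
  have hd : DifferentiableAt ℝ (hess f) z :=
    differentiableAt_of_contDiffAt (contDiffAt_fderiv (contDiffAt_fderiv hf.self_of_nhds))
  have h (Y Z : Coord n) := (hd.hasFDerivAt.clm_apply (hasFDerivAt_const Y z)).clm_apply
    (hasFDerivAt_const Z z)
  have h' := (h Z Y).congr_of_eventuallyEq (f₁ := fun w => hess f w Y Z)
    (hf.mono fun w hw => hess_symm hw Y Z)
  simpa using congrArg (fun L => L X) ((h Y Z).unique h')

theorem jet_one_opS_eq_zero_iff (S : Coord n → Coord n) {f : Coord n → ℝ} {z : Coord n}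
    (hf : ∀ᶠ w in 𝓝 z, ContDiffAt ℝ ∞ f w) :
    jet 1 (opS S f) z = 0 ↔ sprayForm S f z = 0 ∧ fderiv ℝ (sprayForm S f) z = 0 := by
  have h : opS S f =ᶠ[𝓝 z] (oneFormEquiv n) ∘ sprayForm S f := hf.mono fun w hw => opS_eq S hw
  rw [jet_one_eq_zero_iff, h.fderiv_eq, h.self_of_nhds, LinearIsometryEquiv.comp_fderiv]
  refine and_congr (by simp) ⟨fun H => ?_, fun H => by rw [H]; simp⟩
  refine ContinuousLinearMap.ext fun Z => ?_
  have := congrArg (fun L => L Z) H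
  simpa using this

theorem jet_zero_opS_eq_zero_iff (S : Coord n → Coord n) {f : Coord n → ℝ} {z : Coord n}
    (hf : ContDiffAt ℝ ∞ f z) : jet 0 (opS S f) z = 0 ↔ sprayForm S f z = 0 := by
  rw [jet_zero_eq_zero_iff, opS_eq S hf]
  simp

/-! ### The connection, the obstruction and the lift in coordinates -/

theorem vertEnd_fderiv {S : Coord n → Coord n} {z : Coord n} (hS : DifferentiableAt ℝ S z)
    (hJ : ∀ᶠ w in 𝓝 z, vertEnd n (S w) = liouville w) (Z : Coord n) :
    vertEnd n (fderiv ℝ S z Z) = (0, Z.2) := by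
  have h1 : HasFDerivAt (fun w => vertEnd n (S w)) ((vertEnd n).comp (fderiv ℝ S z)) z :=
    (vertEnd n).hasFDerivAt.comp z hS.hasFDerivAt
  have h2 := (hasFDerivAt_liouville z).congr_of_eventuallyEq (f₁ := fun w => vertEnd n (S w)) hJ
  exact congrArg (fun L => L Z) (h1.unique h2)

theorem connection_eq {S : Coord n → Coord n} {z : Coord n} (hS : DifferentiableAt ℝ S z)
    (hJ : ∀ᶠ w in 𝓝 z, vertEnd n (S w) = liouville w) (X : Coord n) :
    connection S z X = fderiv ℝ S z (vertEnd n X) - (0, X.2) := by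
  simp only [connection, VectorField.lieBracket, fderiv_fun_const, Pi.zero_apply,
    zero_apply, sub_zero]
  rw [vertEnd_fderiv hS hJ]

/-- The obstruction `i_Γ d d_J f` is the antisymmetric part of the derivatives of the two operators
along vertical directions. -/
theorem iGammaDDJ_eq {S : Coord n → Coord n} {f : Coord n → ℝ} {z : Coord n}
    (hf : ∀ᶠ w in 𝓝 z, ContDiffAt ℝ ∞ f w) (hS : DifferentiableAt ℝ S z)
    (hJ : ∀ᶠ w in 𝓝 z, vertEnd n (S w) = liouville w) (X Y : Coord n) :
    iGammaDDJ S f z X Y =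
      (fderiv ℝ (sprayForm S f) z (vertEnd n X) Y + hess (opC f) z (vertEnd n X) Y)
      - (fderiv ℝ (sprayForm S f) z (vertEnd n Y) X + hess (opC f) z (vertEnd n Y) X) := by
  have hfz := hf.self_of_nhds
  have hsym := hess_symm hfz
  have hsym₃ : fderiv ℝ (hess f) z (vertEnd n X) (S z) (vertEnd n Y)
      = fderiv ℝ (hess f) z (vertEnd n Y) (S z) (vertEnd n X) := by
    rw [fderiv_hess_symm₁₂ hfz, fderiv_hess_symm₂₃ hf, fderiv_hess_symm₁₂ hfz]
  -- JΓ = J, from differentiating JS = C along JX.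
  have hJΓ : ∀ X, vertEnd n (connection S z X) = vertEnd n X := fun X => by
    rw [connection_eq hS hJ, map_sub, vertEnd_fderiv hS hJ]
    simp
  rw [iGammaDDJ, ddJ_apply hfz, ddJ_apply hfz, hJΓ, hJΓ, connection_eq hS hJ, connection_eq hS hJ,
    fderiv_sprayForm hfz hS, fderiv_sprayForm hfz hS, hess_opC hf, hess_opC hf,
    vertEnd_fderiv hS hJ, vertEnd_fderiv hS hJ, hJ.self_of_nhds, hsym₃]
  simp only [map_sub, sub_apply]
  have e : ∀ X : Coord n, ((0, (vertEnd n X).2) : Coord n) = vertEnd n X := fun X => rfl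
  rw [e, e, hsym (0, Y.2) (vertEnd n X), hsym (0, X.2) (vertEnd n Y), hsym Y (vertEnd n X),
    hsym X (vertEnd n Y)]
  ring

theorem eventually_fderiv_add {V : Type*} [NormedAddCommGroup V] [NormedSpace ℝ V]
    {f g : Coord n → V} {z : Coord n} (hf : ∀ᶠ w in 𝓝 z, ContDiffAt ℝ ∞ f w)
    (hg : ∀ᶠ w in 𝓝 z, ContDiffAt ℝ ∞ g w) :
    fderiv ℝ (f + g) =ᶠ[𝓝 z] fderiv ℝ f + fderiv ℝ g := by
  filter_upwards [hf, hg] with w hfw hgw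
  exact fderiv_add (differentiableAt_of_contDiffAt hfw) (differentiableAt_of_contDiffAt hgw)

/-- Sufficiency in coordinates: the correction is the cubic whose third derivative solves the
contraction problem. -/
theorem exists_lift {S : Coord n → Coord n} {f : Coord n → ℝ} {z : Coord n}
    (hf : ∀ᶠ w in 𝓝 z, ContDiffAt ℝ ∞ f w) (hS : DifferentiableAt ℝ S z)
    (hJ : ∀ᶠ w in 𝓝 z, vertEnd n (S w) = liouville w) (hz : z.2 ≠ 0)
    (hP : sprayForm S f z = 0) (hC : opC f z = 0) (hC' : fderiv ℝ (opC f) z = 0)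
    (hΓ : ∀ X Y, iGammaDDJ S f z X Y = 0) :
    ∃ Q : Coord n → ℝ, ContDiff ℝ ∞ Q ∧ jet 2 (f + Q) z = jet 2 f z ∧
      jet 1 (opS S (f + Q)) z = 0 ∧ jet 2 (opC (f + Q)) z = 0 := by
  have hfz := hf.self_of_nhds
  have hJz := hJ.self_of_nhds
  have hsym := hess_symm hfz
  have hσ := hess_symm (contDiffAt_opC hfz)
  have hc : liouville z ≠ 0 := fun h => hz (congrArg Prod.snd h)
  obtain ⟨T, h₁₂, h₂₃, hTc, hTs⟩ := exists_trilinear (S z) (liouville z) hJz hc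
    (-hess (opC f) z) (-(fderiv ℝ (sprayForm S f) z).flip - (hess (opC f) z).flip)
    (fun X Y => by simp only [neg_apply]; rw [hσ])
    (fun X Z => by
      simp only [sub_apply, neg_apply, ContinuousLinearMap.flip_apply]
      rw [fderiv_sprayForm hfz hS, hess_opC hf, hJz, vertEnd_fderiv hS hJ]
      have : vertEnd n (vertEnd n X) = 0 := by simp
      have e : ((0, (vertEnd n X).2) : Coord n) = vertEnd n X := rfl
      rw [this, e]
      simp only [map_zero]
      ring)
    (fun Z => by
      -- Because ρ(S) vanishes identically, (∂_Z ρ)(S) = -ρ(∂_Z S), which is zero at the point.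
      have h0 : fderiv ℝ (sprayForm S f) z Z (S z) = 0 := by
        have := congrArg (fun L => L (fderiv ℝ S z Z)) hP
        simp only [sprayForm_apply, zero_apply] at this
        rw [fderiv_sprayForm hfz hS]
        linarith
      simp only [sub_apply, neg_apply, ContinuousLinearMap.flip_apply]
      rw [h0, hσ]
      ring)
    (fun X Y => by
      have := hΓ X Y
      rw [iGammaDDJ_eq hf hS hJ] at this
      simp only [sub_apply, neg_apply, ContinuousLinearMap.flip_apply]
      linarith)
  obtain ⟨Q, hQ, q0, q1, q2, q3⟩ := exists_cubic T h₁₂ h₂₃ z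
  have hQe : ∀ᶠ w in 𝓝 z, ContDiffAt ℝ ∞ Q w := .of_forall fun w => hQ.contDiffAt
  have hg : ∀ᶠ w in 𝓝 z, ContDiffAt ℝ ∞ (f + Q) w := by
    filter_upwards [hf, hQe] with w h1 h2 using h1.add h2
  have hgz := hg.self_of_nhds
  have e1 := eventually_fderiv_add hf hQe
  have e2 : hess (f + Q) =ᶠ[𝓝 z] hess f + hess Q :=
    e1.fderiv.trans (eventually_fderiv_add (hf.mono fun w hw => contDiffAt_fderiv hw)
      (hQe.mono fun w hw => contDiffAt_fderiv hw))
  have g0 : (f + Q) z = f z := by simp [q0]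
  have g1 : fderiv ℝ (f + Q) z = fderiv ℝ f z := by simp [e1.self_of_nhds, q1]
  have g2 : hess (f + Q) z = hess f z := by
    have q2' : hess Q z = 0 := q2
    rw [e2.self_of_nhds, Pi.add_apply, q2', add_zero]
  have g3 : fderiv ℝ (hess (f + Q)) z = fderiv ℝ (hess f) z + T := by
    rw [e2.fderiv_eq, fderiv_add
      (differentiableAt_of_contDiffAt (contDiffAt_fderiv (contDiffAt_fderiv hfz)))
      (differentiableAt_of_contDiffAt (contDiffAt_fderiv (contDiffAt_fderiv hQ.contDiffAt))), q3]
  have hρg : ∀ Z X, fderiv ℝ (sprayForm S (f + Q)) z Z X = fderiv ℝ (sprayForm S f) z Z X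
      + T Z (S z) (vertEnd n X) - T Z X (liouville z) := fun Z X => by
    rw [fderiv_sprayForm hgz hS, fderiv_sprayForm hfz hS, g2, g3, hJz]
    simp only [add_apply]
    ring
  have hσg : ∀ Z X, hess (opC (f + Q)) z Z X = hess (opC f) z Z X + T Z X (liouville z) :=
    fun Z X => by
      rw [hess_opC hg, hess_opC hf, g2, g3]
      simp only [add_apply]
      ring
  have t1 : ∀ Z X, T Z X (liouville z) = -hess (opC f) z Z X := fun Z X => by
    rw [h₂₃, h₁₂, hTc]; simp
  have t2 : ∀ Z X, T Z (S z) (vertEnd n X) =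
      - fderiv ℝ (sprayForm S f) z Z X - hess (opC f) z Z X := fun Z X => by
    rw [h₁₂, h₂₃, hTs]; simp
  refine ⟨Q, hQ, jet_eq_iff_two.2 ⟨g0, g1, g2⟩, (jet_one_opS_eq_zero_iff S hg).2 ⟨?_, ?_⟩,
    jet_two_eq_zero_iff.2 ⟨?_, ?_, ?_⟩⟩
  · rw [← hP]
    simp only [sprayForm, g2]
  · refine ContinuousLinearMap.ext fun Z => ContinuousLinearMap.ext fun X => ?_
    rw [hρg, t1, t2, zero_apply, zero_apply]
    ring
  · rw [← hC]
    simp only [opC, g0, g1]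
  · rw [← hC']
    refine ContinuousLinearMap.ext fun X => ?_
    rw [fderiv_opC hgz, fderiv_opC hfz, g1, g2]
  · refine ContinuousLinearMap.ext fun Z => ContinuousLinearMap.ext fun X => ?_
    rw [hσg, t1]
    simp

/-- The obstruction depends only on the two-jet of the function. -/
theorem iGammaDDJ_congr (S : Coord n → Coord n) {f g : Coord n → ℝ} {z : Coord n}
    (hf : ContDiffAt ℝ ∞ f z) (hg : ContDiffAt ℝ ∞ g z) (h : hess f z = hess g z)
    (X Y : Coord n) : iGammaDDJ S f z X Y = iGammaDDJ S g z X Y := by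
  simp only [iGammaDDJ, ddJ_apply hf, ddJ_apply hg, h]

theorem iGammaDDJ_eq_zero_of_jet {S : Coord n → Coord n} {f : Coord n → ℝ} {z : Coord n}
    (hf : ∀ᶠ w in 𝓝 z, ContDiffAt ℝ ∞ f w) (hS : DifferentiableAt ℝ S z)
    (hJ : ∀ᶠ w in 𝓝 z, vertEnd n (S w) = liouville w)
    (hP : jet 1 (opS S f) z = 0) (hC : jet 2 (opC f) z = 0) (X Y : Coord n) :
    iGammaDDJ S f z X Y = 0 := by
  have hP' := ((jet_one_opS_eq_zero_iff S hf).1 hP).2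
  have hC' : hess (opC f) z = 0 := (jet_two_eq_zero_iff.1 hC).2.2
  rw [iGammaDDJ_eq hf hS hJ, hP', hC']
  simp

/-! ### Passage to the manifold -/

theorem opS_congr (S : Coord n → Coord n) {f g : Coord n → ℝ} {z : Coord n} (h : f =ᶠ[𝓝 z] g) :
    opS S f =ᶠ[𝓝 z] opS S g := by
  have h1 : dJ f =ᶠ[𝓝 z] dJ g := (h.fderiv (𝕜 := ℝ)).mono fun w hw => by simp only [dJ, hw]
  exact h1.extDeriv.mono fun w hw => by simp only [opS, ddJ, hw]

theorem opC_congr {f g : Coord n → ℝ} {z : Coord n} (h : f =ᶠ[𝓝 z] g) :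
    opC f =ᶠ[𝓝 z] opC g := by
  filter_upwards [h, h.fderiv (𝕜 := ℝ)] with w h1 h2
  simp only [opC, h1, h2]

theorem jet_congr {V : Type*} [NormedAddCommGroup V] [NormedSpace ℝ V] (k : ℕ)
    {f g : Coord n → V} {z : Coord n} (h : f =ᶠ[𝓝 z] g) : jet k f z = jet k g z := by
  funext i
  exact (h.iteratedFDeriv ℝ i).self_of_nhds

variable {M : Type*} [TopologicalSpace M] [ChartedSpace (EuclideanSpace ℝ (Fin n)) M]
  [IsManifold (𝓡 n) ∞ M]

theorem coords_snd_self (p : TangentBundle (𝓡 n) M) : (coords p p).2 = p.2 := by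
  exact (tangentBundleCore (𝓡 n) M).coordChange_self (achart _ p.1) p.1
    (mem_achart_source _ p.1) p.2

theorem snd_ne_zero_of_coords {p q : TangentBundle (𝓡 n) M} (h : (coords p q).2 ≠ 0) :
    q.2 ≠ 0 := by
  intro h0
  apply h
  change (tangentBundleCore (𝓡 n) M).coordChange (achart _ q.1) (achart _ p.1) q.1 q.2 = 0
  rw [h0]
  exact map_zero _

theorem eventually_coords_snd_ne_zero {p : TangentBundle (𝓡 n) M} (hp : p.2 ≠ 0) :
    ∀ᶠ z in 𝓝 (coords p p), z.2 ≠ 0 :=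
  continuous_snd.continuousAt.eventually_ne (by rwa [coords_snd_self])

theorem target_mem_nhds (p : TangentBundle (𝓡 n) M) :
    (extChartAt (𝓡 n).tangent p).target ∈ 𝓝 (coords p p) :=
  extChartAt_target_mem_nhds (I := (𝓡 n).tangent) p

theorem symm_coords (p : TangentBundle (𝓡 n) M) :
    (extChartAt (𝓡 n).tangent p).symm (coords p p) = p :=
  extChartAt_to_inv (I := (𝓡 n).tangent) p

theorem contMDiffAt_extChartAt_symm {p : TangentBundle (𝓡 n) M} {z : Coord n}
    (hz : z ∈ (extChartAt (𝓡 n).tangent p).target) :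
    ContMDiffAt 𝓘(ℝ, Coord n) (𝓡 n).tangent ∞ (extChartAt (𝓡 n).tangent p).symm z :=
  (contMDiffOn_extChartAt_symm p).contMDiffAt
    ((isOpen_extChartAt_target (I := (𝓡 n).tangent) p).mem_nhds hz)

theorem eventually_contDiffAt_localFun {F : TangentBundle (𝓡 n) M → ℝ}
    {p : TangentBundle (𝓡 n) M} (hF : SmoothNear F p) :
    ∀ᶠ z in 𝓝 (coords p p), ContDiffAt ℝ ∞ (localFun F p) z := by
  have hc : Filter.Tendsto (extChartAt (𝓡 n).tangent p).symm (𝓝 (coords p p)) (𝓝 p) := by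
    have := (contMDiffAt_extChartAt_symm (mem_of_mem_nhds (target_mem_nhds p))).continuousAt
    rwa [ContinuousAt, symm_coords] at this
  filter_upwards [hc.eventually hF, target_mem_nhds p] with z h1 h2
  exact (ContMDiffAt.comp z h1 (contMDiffAt_extChartAt_symm h2)).contDiffAt

/-- Near p, the components of S are its reading in the tangent trivialization at p, which is smooth
because the slit bundle is a neighbourhood of p. -/
theorem IsSpray.differentiableAt_localField
    {S : ∀ q : TangentBundle (𝓡 n) M, TangentSpace (𝓡 n).tangent q} (hS : IsSpray S)
    {p : TangentBundle (𝓡 n) M} (hp : p.2 ≠ 0) :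
    DifferentiableAt ℝ (localField S p) (coords p p) := by
  have hmem : {q : TangentBundle (𝓡 n) M | q.2 ≠ 0} ∈ 𝓝 p := by
    have h : Filter.Tendsto (coords p) (𝓝 p) (𝓝 (coords p p)) :=
      continuousAt_extChartAt (I := (𝓡 n).tangent) p
    filter_upwards [h.eventually (eventually_coords_snd_ne_zero hp)] with q hq
    exact snd_ne_zero_of_coords hq
  have h1 := (Bundle.contMDiffAt_section p).1 (hS.smooth.contMDiffAt hmem)
  rw [← symm_coords p] at h1
  have h2 := (h1.comp (coords p p)
    (contMDiffAt_extChartAt_symm (mem_of_mem_nhds (target_mem_nhds p)))).contDiffAt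
  have h3 := differentiableAt_of_contDiffAt h2
  refine h3.congr_of_eventuallyEq ?_
  filter_upwards [target_mem_nhds p] with z hz
  have hq := (extChartAt (𝓡 n).tangent p).map_target hz
  rw [extChartAt_source] at hq
  have hb : (extChartAt (𝓡 n).tangent p).symm z ∈ (trivializationAt (Coord n)
      (TangentSpace (𝓡 n).tangent : TangentBundle (𝓡 n) M → Type _) p).baseSet := hq
  have he := congrFun (Bundle.Trivialization.coe_linearMapAt_of_mem (R := ℝ) _ hb)
    (S ((extChartAt (𝓡 n).tangent p).symm z))
  simp only [localField, Function.comp_apply, symm_coords]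
  rw [← TangentBundle.continuousLinearMapAt_trivializationAt (I := (𝓡 n).tangent) hq]
  exact he

theorem IsSpray.eventually_vertEnd
    {S : ∀ q : TangentBundle (𝓡 n) M, TangentSpace (𝓡 n).tangent q} (hS : IsSpray S)
    {p : TangentBundle (𝓡 n) M} (hp : p.2 ≠ 0) :
    ∀ᶠ z in 𝓝 (coords p p), vertEnd n (localField S p z) = liouville z := by
  filter_upwards [target_mem_nhds p, eventually_coords_snd_ne_zero hp] with z h1 h2
  exact hS.vertEnd_eq p z h1 h2

/-- A smooth function of the induced coordinates can be added to a function near `p`. -/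
theorem exists_localFun_add {F : TangentBundle (𝓡 n) M → ℝ} {p : TangentBundle (𝓡 n) M}
    (hF : SmoothNear F p) {Q : Coord n → ℝ} (hQ : ContDiff ℝ ∞ Q) :
    ∃ G : TangentBundle (𝓡 n) M → ℝ, SmoothNear G p ∧
      localFun G p =ᶠ[𝓝 (coords p p)] localFun F p + Q := by
  refine ⟨fun q => F q + Q (coords p q), ?_, ?_⟩
  · filter_upwards [hF, extChartAt_source_mem_nhds (I := (𝓡 n).tangent) p] with q h1 h2
    rw [extChartAt_source] at h2
    exact h1.add (hQ.contMDiff.contMDiffAt.comp q (contMDiffAt_extChartAt' h2))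
  · filter_upwards [target_mem_nhds p] with z hz
    have : coords p ((extChartAt (𝓡 n).tangent p).symm z) = z :=
      (extChartAt (𝓡 n).tangent p).right_inv hz
    simp only [localFun, Pi.add_apply, this]

end Rapcsak

end

theorem mainTheorem4 {n : ℕ} {M : Type*} [TopologicalSpace M]
    [ChartedSpace (EuclideanSpace ℝ (Fin n)) M] [IsManifold (𝓡 n) ∞ M]
    (S : ∀ q : TangentBundle (𝓡 n) M, TangentSpace (𝓡 n).tangent q) (hS : Rapcsak.IsSpray S)
    (p : TangentBundle (𝓡 n) M) (hp : p.2 ≠ 0)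
    (F : TangentBundle (𝓡 n) M → ℝ) (hF : Rapcsak.SmoothNear F p)
    (hsol : Rapcsak.IsFormalSolution 0 S F p) :
    (∃ G : TangentBundle (𝓡 n) M → ℝ, Rapcsak.SmoothNear G p ∧
      Rapcsak.jetAt 2 G p = Rapcsak.jetAt 2 F p ∧ Rapcsak.IsFormalSolution 1 S G p) ↔
      Rapcsak.ObstructionVanishes S F p := by
  have hf := Rapcsak.eventually_contDiffAt_localFun hF
  have hSd := hS.differentiableAt_localField hp
  have hJ := hS.eventually_vertEnd hp
  constructor
  · rintro ⟨G, hG, hjet, hsolG⟩ X Y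
    have hg := Rapcsak.eventually_contDiffAt_localFun hG
    have hj : Rapcsak.jet 2 (Rapcsak.localFun G p) (Rapcsak.coords p p)
      = Rapcsak.jet 2 (Rapcsak.localFun F p) (Rapcsak.coords p p) := funext (congrFun hjet)
    -- F and G share their second derivatives, so the obstruction may be computed from G.
    rw [Rapcsak.iGammaDDJ_congr _ hf.self_of_nhds hg.self_of_nhds
      (Rapcsak.jet_eq_iff_two.1 hj).2.2.symm]
    exact Rapcsak.iGammaDDJ_eq_zero_of_jet hg hSd hJ hsolG.1 hsolG.2 X Y
  · intro hobs
    obtain ⟨hC, hC'⟩ := Rapcsak.jet_one_eq_zero_iff.1 hsol.2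
    obtain ⟨Q, hQ, hj, hP, hCQ⟩ := Rapcsak.exists_lift hf hSd hJ
      (by rwa [Rapcsak.coords_snd_self]) ((Rapcsak.jet_zero_opS_eq_zero_iff _ hf.self_of_nhds).1
        hsol.1) hC hC' hobs
    obtain ⟨G, hG, hGQ⟩ := Rapcsak.exists_localFun_add hF hQ
    refine ⟨G, hG, ?_, ?_, ?_⟩
    · exact funext fun i => congrFun ((Rapcsak.jet_congr 2 hGQ).trans hj) i
    · exact (Rapcsak.jet_congr 1 (Rapcsak.opS_congr _ hGQ)).trans hP
    · exact (Rapcsak.jet_congr 2 (Rapcsak.opC_congr hGQ)).trans hCQ
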